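/- Let $\alpha_1,\dots,\alpha_5\in\mathbb R^2$ be pairwise distinct points whose convex hull has dimension $2$, and let $\varepsilon\in\{\pm1\}^5$. Put $\mathcal A_+=\{\alpha_i:\varepsilon_i=1\}$ and $\mathcal A_-=\{\alpha_i:\varepsilon_i=-1\}$. Let $B\in\mathbb R^{5\times 2}$ be a Gale dual matrix of $(\alpha_1,\dots,\alpha_5)$, that is, a matrix whose columns form a basis of the kernel of the $3\times5$ matrix with columns $(1,\alpha_i)^\top$, normalized so that its last row is $(0,-1)$. Consider $$\bar\xi_{B,\varepsilon}\colon\Big\{\mu\in\mathbb R:\operatorname{sign}\big(B\begin{bmatrix}\mu\\1\end{bmatrix}\big)=\varepsilon\Big\}\to\mathbb R^2,\qquad \mu\mapsto B^\top\operatorname{Log}\Big|B\begin{bmatrix}\mu\\1\end{bmatrix}\Big|,$$ with $\operatorname{Log}$ and $|\cdot|$ taken coordinatewise. A critical point of $\bar\xi_{B,\varepsilon}$ is a point of its domain at which the Jacobian matrix has rank less than $1$. **(1)** If $\bar\xi_{B,\varepsilon}$ has exactly two critical points, then either $\#\mathcal A_+=3$, $\#\mathcal A_-=2$ and $\dim\operatorname{Conv}(\mathcal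 A_+)=2$, or $\#\mathcal A_+=2$, $\#\mathcal A_-=3$ and $\dim\operatorname{Conv}(\mathcal A_-)=2$. **(2)** Assume $\varepsilon=(1,1,1,-1,-1)$, write $p_0=\alpha_1$, $p_1=\alpha_2$, $p_2=\alpha_3$, and assume that $P=\operatorname{Conv}(p_0,p_1,p_2)$ has dimension $2$. For $i=0,1,2$ let $\{x: v_i\cdot x=d_i\}$ be the line through the vertices of $P$ other than $p_i$, with the sign of $(v_i,d_i)$ chosen so that $P=\bigcap_{i}\{x: v_i\cdot x\ge d_i\}$. For $i\ne j$ put $$P^{+,i,j}=\{x:\ v_l\cdot x\ge d_l\ \text{for all } l\ne i,\quad v_i\cdot x\le d_i,\quad v_j\cdot x\le v_j\cdot p_j\}.$$ Then $\bar\xi_{B,\varepsilon}$ has exactly two critical points if and only if there are $i,j,k$ with $\{i,j,k\}=\{0,1,2\}$ such that $$\alpha_4\in\operatorname{int}P^{+,j,i},\qquad \alpha_5\in\operatorname{int}P^{+,i,j},$$ and the following inequalities hold. Let $M\in\mathbb R^{2\times2}$ be the invertible matrix with $M(p_j-p_k)=e_1$ and $M(p_i-p_k)=e_2$, let $v=-Mp_k$,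 let $(x_1,y_1)^\top=M\alpha_4+v$ and $(x_2,y_2)^\top=M\alpha_5+v$, and let $$\begin{aligned}a&=-x_1y_1(1-x_1-y_1),\qquad c=-x_2y_2(1-x_2-y_2),\\ b&=-x_1^2y_2^2+2x_1x_2y_1y_2-x_2^2y_1^2+x_1^2y_2+y_2^2x_1+x_2^2y_1+y_1^2x_2-x_1y_2-x_2y_1.\end{aligned}$$ The inequalities are $$\begin{aligned}& b^2-4ac>0,\\ & b^2-4ac<\big(2x_2y_1(1-x_1-y_1)+b\big)^2,\qquad 0<2x_2y_1(1-x_1-y_1)+b,\\ & b^2-4ac<\big(2x_1y_2(1-x_1-y_1)+b\big)^2,\qquad 0>2x_1y_2(1-x_1-y_1)+b.\end{aligned}$$ -/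

import Mathlib

open scoped Matrix

noncomputable section

namespace FiveNomial

/-! ### Exponent vectors, Gale duality -/

/-- The dimension of the convex hull of a set of points of `ℝⁿ`, i.e. the dimension of
the direction of its affine hull. -/
def convDim {n : ℕ} (S : Set (Fin n → ℝ)) : ℕ :=
  Module.finrank ℝ (vectorSpan ℝ (convexHull ℝ S))

/-- The exponent vectors with positive sign. -/
def posPart {m n : ℕ} (α : Fin m → Fin n → ℝ) (ε : Fin m → SignType) : Set (Fin n → ℝ) :=
  α '' {i | ε i = 1}

/-- The exponent vectors with negative sign. -/
def negPart {m n : ℕ} (α : Fin m → Fin n → ℝ) (ε : Fin m → SignType) : Set (Fin n → ℝ) :=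
  α '' {i | ε i = -1}

/-- The `(n+1) × m` matrix `Â` whose columns are the vectors `(1, α i)`. -/
def hatMatrix {m n : ℕ} (α : Fin m → Fin n → ℝ) : Matrix (Fin (n + 1)) (Fin m) ℝ :=
  Matrix.of fun r i => (Fin.cons 1 (α i) : Fin (n + 1) → ℝ) r

/-- `B` is a Gale dual matrix of `α`: its columns form a basis of `ker Â`. -/
def IsGaleDual {m n k : ℕ} (α : Fin m → Fin n → ℝ) (B : Matrix (Fin m) (Fin k) ℝ) : Prop :=
  LinearIndependent ℝ (fun j : Fin k => fun i : Fin m => B i j) ∧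
    Submodule.span ℝ (Set.range fun j : Fin k => fun i : Fin m => B i j) =
      LinearMap.ker (hatMatrix α).mulVecLin

/-! ### The affine parametrization of the signed reduced discriminant -/

/-- The vector `(μ, 1)`. -/
def homog {k : ℕ} (μ : Fin k → ℝ) : Fin (k + 1) → ℝ :=
  Fin.snoc (α := fun _ => ℝ) μ 1

/-- The domain `{μ | sign (B (μ, 1)) = ε}` of the parametrization. -/
def paramDomain {m k : ℕ} (B : Matrix (Fin m) (Fin (k + 1)) ℝ) (ε : Fin m → SignType) :
    Set (Fin k → ℝ) :=
  {μ | ∀ i, SignType.sign ((B *ᵥ homog μ) i) = ε i}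

/-- The formula `μ ↦ Bᵀ Log |B (μ, 1)|` of the parametrization. It is only used on
`paramDomain B ε` with nonzero signs `ε`, an open set on which it is smooth. -/
def paramMap {m k : ℕ} (B : Matrix (Fin m) (Fin (k + 1)) ℝ) (μ : Fin k → ℝ) :
    Fin (k + 1) → ℝ :=
  Bᵀ *ᵥ fun i => Real.log |(B *ᵥ homog μ) i|

/-- The Jacobian matrix of a map `ℝᵏ → ℝˡ` at a point. -/
def jacobian {k l : ℕ} (f : (Fin k → ℝ) → (Fin l → ℝ)) (μ : Fin k → ℝ) :
    Matrix (Fin l) (Fin k) ℝ :=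
  LinearMap.toMatrix' (fderiv ℝ f μ : (Fin k → ℝ) →ₗ[ℝ] (Fin l → ℝ))

/-- The critical points of the parametrization: the points of its domain at which the
Jacobian matrix does not have full rank. -/
def criticalPoints {m k : ℕ} (B : Matrix (Fin m) (Fin (k + 1)) ℝ) (ε : Fin m → SignType) :
    Set (Fin k → ℝ) :=
  {μ | μ ∈ paramDomain B ε ∧ (jacobian (paramMap B) μ).rank < k}

/-! ### The chambers cut out by the facet hyperplanes of a triangle -/

/-- The affine hyperplane `{x | v ⬝ x = a}`. -/
def hyperplane {n : ℕ} (v : Fin n → ℝ) (a : ℝ) : Set (Fin n → ℝ) := {x | v ⬝ᵥ x = a}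

/-- The closed half-space `{x | v ⬝ x ≥ a}`. -/
def upperHalf {n : ℕ} (v : Fin n → ℝ) (a : ℝ) : Set (Fin n → ℝ) := {x | a ≤ v ⬝ᵥ x}

/-- The closed half-space `{x | v ⬝ x ≤ a}`. -/
def lowerHalf {n : ℕ} (v : Fin n → ℝ) (a : ℝ) : Set (Fin n → ℝ) := {x | v ⬝ᵥ x ≤ a}

/-- The hyperplanes `v i ⬝ x = d i` are the supporting hyperplanes of the facets of the triangle
with vertices `p 0, p 1, p 2`, the `i`-th one being that of the facet opposite to `p i`, with the
triangle on the upper side of each of them. -/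
structure IsFacetHyperplanes (p : Fin 3 → Fin 2 → ℝ) (v : Fin 3 → Fin 2 → ℝ) (d : Fin 3 → ℝ) :
    Prop where
  ne_zero : ∀ i, v i ≠ 0
  facet : ∀ i j, j ≠ i → p j ∈ hyperplane (v i) (d i)
  opposite : ∀ i, p i ∉ hyperplane (v i) (d i)
  hull_eq : convexHull ℝ (Set.range p) = ⋂ i, upperHalf (v i) (d i)

/-- The chamber `P^{+,i}`, adjacent to the triangle along the facet opposite to `p i`. -/
def posChamber (v : Fin 3 → Fin 2 → ℝ) (d : Fin 3 → ℝ) (i : Fin 3) : Set (Fin 2 → ℝ) :=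
  (⋂ l ∈ {l : Fin 3 | l ≠ i}, upperHalf (v l) (d l)) ∩ lowerHalf (v i) (d i)

/-- The part `P^{+,i,j}` of `P^{+,i}` that lies below the line through `p j` parallel to
the facet opposite to `p j`. -/
def posSubChamber (p : Fin 3 → Fin 2 → ℝ) (v : Fin 3 → Fin 2 → ℝ) (d : Fin 3 → ℝ)
    (i j : Fin 3) : Set (Fin 2 → ℝ) :=
  posChamber v d i ∩ lowerHalf (v j) (v j ⬝ᵥ p j)

/-! ### The coefficients of the quadratic `a t² + b t + c` -/

/-- The leading coefficient, for the points `(x₁, y₁)` and `(x₂, y₂)`. -/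
def coeffA (x₁ y₁ : ℝ) : ℝ := -x₁ * y₁ * (1 - x₁ - y₁)

/-- The middle coefficient. -/
def coeffB (x₁ y₁ x₂ y₂ : ℝ) : ℝ :=
  -x₁ ^ 2 * y₂ ^ 2 + 2 * x₁ * x₂ * y₁ * y₂ - x₂ ^ 2 * y₁ ^ 2 + x₁ ^ 2 * y₂ + y₂ ^ 2 * x₁
    + x₂ ^ 2 * y₁ + y₁ ^ 2 * x₂ - x₁ * y₂ - x₂ * y₁

/-- The constant coefficient. -/
def coeffC (x₂ y₂ : ℝ) : ℝ := -x₂ * y₂ * (1 - x₂ - y₂)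

/-- The polynomial inequalities in the coordinates `(x₁, y₁)` and `(x₂, y₂)`. -/
def CuspInequalities (x₁ y₁ x₂ y₂ : ℝ) : Prop :=
  let a := coeffA x₁ y₁
  let b := coeffB x₁ y₁ x₂ y₂
  let c := coeffC x₂ y₂
  0 < b ^ 2 - 4 * a * c ∧
  b ^ 2 - 4 * a * c < (2 * x₂ * y₁ * (1 - x₁ - y₁) + b) ^ 2 ∧
  0 < 2 * x₂ * y₁ * (1 - x₁ - y₁) + b ∧
  b ^ 2 - 4 * a * c < (2 * x₁ * y₂ * (1 - x₁ - y₁) + b) ^ 2 ∧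
  2 * x₁ * y₂ * (1 - x₁ - y₁) + b < 0

end FiveNomial

end

namespace FiveNomial

/-! Write λ = B(μ,1)ᵀ and let q(c) = ∑ cᵢ²/λᵢ on the kernel of Â. Since λ lies in this kernel and
every kernel vector has coordinate sum zero, λ is in the radical of q. The kernel is spanned by λ
and the first column of B, and μ is critical exactly when q vanishes on that column; so at a
critical point q vanishes on the whole kernel. An affine relation among points of one sign would be
a kernel vector on which q is definite. Hence each sign class is affinely independent, has at most
three points in the plane, and five points must split as 3 and 2. One critical point already
suffices for this.

For the characterization, let s and t be the barycentric coordinates of the two negative points in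
the positive triangle. The kernel is spanned by (s,-1,0) and (t,0,-1), and the normalization of B
gives λ = (us+t, -u, -1) with u an invertible affine function of μ. The condition q(s,-1,0) = 0
becomes ∑ sₗtₗ/(usₗ+tₗ) = 0, and clearing denominators turns it into au²+bu+c = 0. Monotonicity and
Vieta's formulas show that two admissible roots force the sign pattern of the chambers. Under that
pattern the admissible u form the interval from -tᵢ/sᵢ to -tⱼ/sⱼ, and the inequalities say that the
two roots are real, distinct and inside it. -/

/-! ### Counting critical parameters in barycentric coordinates -/

theorem sum_eq_of_distinct {i j k : Fin 3} (hij : i ≠ j) (hki : k ≠ i) (hkj : k ≠ j)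
    (f : Fin 3 → ℝ) : ∑ l, f l = f i + f j + f k := by
  have h : (Finset.univ : Finset (Fin 3)) = {i, j, k} := by
    revert i j k; decide
  rw [h, Finset.sum_insert, Finset.sum_pair hkj.symm, add_assoc]
  simp [hij, hki.symm]

theorem forall_iff_of_distinct {i j k : Fin 3} (hij : i ≠ j) (hki : k ≠ i) (hkj : k ≠ j)
    (P : Fin 3 → Prop) : (∀ l, P l) ↔ P i ∧ P j ∧ P k := by
  have h : ∀ l, l = i ∨ l = j ∨ l = k := by
    revert i j k; decide
  refine ⟨fun H => ⟨H i, H j, H k⟩, fun ⟨h1, h2, h3⟩ l => ?_⟩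
  rcases h l with rfl | rfl | rfl <;> assumption

theorem exists_third (i j : Fin 3) : ∃ k, k ≠ i ∧ k ≠ j := by
  revert i j; decide

/-- The critical parameters, in terms of the barycentric coordinates `s` and `t` of the two
negative exponents with respect to the triangle of positive exponents. -/
def critParams (s t : Fin 3 → ℝ) : Set ℝ :=
  {u | 0 < u ∧ (∀ l, 0 < u * s l + t l) ∧ ∑ l, s l * t l / (u * s l + t l) = 0}

theorem quadratic_eq {x₁ y₁ z₁ x₂ y₂ z₂ u : ℝ} (h₁ : y₁ + x₁ + z₁ = 1) (h₂ : y₂ + x₂ + z₂ = 1)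
    (hx : 0 < u * x₁ + x₂) (hy : 0 < u * y₁ + y₂) (hz : 0 < u * z₁ + z₂) :
    y₁ * y₂ / (u * y₁ + y₂) + x₁ * x₂ / (u * x₁ + x₂) + z₁ * z₂ / (u * z₁ + z₂) = 0 ↔
      coeffA x₁ y₁ * u ^ 2 + coeffB x₁ y₁ x₂ y₂ * u + coeffC x₂ y₂ = 0 := by
  obtain rfl : z₁ = 1 - x₁ - y₁ := by linarith
  obtain rfl : z₂ = 1 - x₂ - y₂ := by linarith
  have key : (y₁ * y₂ / (u * y₁ + y₂) + x₁ * x₂ / (u * x₁ + x₂) +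
      (1 - x₁ - y₁) * (1 - x₂ - y₂) / (u * (1 - x₁ - y₁) + (1 - x₂ - y₂))) =
      -(coeffA x₁ y₁ * u ^ 2 + coeffB x₁ y₁ x₂ y₂ * u + coeffC x₂ y₂) /
        ((u * y₁ + y₂) * (u * x₁ + x₂) * (u * (1 - x₁ - y₁) + (1 - x₂ - y₂))) := by
    rw [div_add_div _ _ hy.ne' hx.ne', div_add_div _ _ (mul_pos hy hx).ne' hz.ne']
    congr 1
    unfold coeffA coeffB coeffC
    ring
  rw [key, div_eq_zero_iff, neg_eq_zero]
  simp [hx.ne', hy.ne', hz.ne']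

theorem mem_critParams_iff {s t : Fin 3 → ℝ} (hs : ∑ l, s l = 1) (ht : ∑ l, t l = 1)
    {i j k : Fin 3} (hij : i ≠ j) (hki : k ≠ i) (hkj : k ≠ j) {u : ℝ} :
    u ∈ critParams s t ↔ 0 < u ∧ 0 < u * s i + t i ∧ 0 < u * s j + t j ∧ 0 < u * s k + t k ∧
      coeffA (s j) (s i) * u ^ 2 + coeffB (s j) (s i) (t j) (t i) * u +
        coeffC (t j) (t i) = 0 := by
  rw [sum_eq_of_distinct hij hki hkj] at hs ht
  simp only [critParams, Set.mem_ofPred_eq, sum_eq_of_distinct hij hki hkj,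
    forall_iff_of_distinct hij hki hkj, and_assoc]
  refine and_congr_right fun _ => and_congr_right fun h1 => and_congr_right fun h2 =>
    and_congr_right fun h3 => quadratic_eq hs ht h2 h1 h3

/-- If all sₗ were positive, z·∑ sₗtₗ/(zsₗ+tₗ) would be strictly increasing in z, each term having
derivative tₗ²sₗ/(zsₗ+tₗ)², so it could not vanish twice. Some tₗ is positive because they sum to 1;
this makes the monotonicity strict. -/
theorem exists_neg_fst {s t : Fin 3 → ℝ} {u w : ℝ} (hu : u ∈ critParams s t)
    (hw : w ∈ critParams s t) (huw : u < w) (ht : ∑ l, t l = 1) : ∃ l, s l ≤ 0 := by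
  by_contra! h
  have hmono : ∀ l, t l * (u * s l) / (u * s l + t l) ≤ t l * (w * s l) / (w * s l + t l) := by
    intro l
    rw [div_le_div_iff₀ (hu.2.1 l) (hw.2.1 l)]
    have := mul_nonneg (mul_nonneg (sq_nonneg (t l)) (h l).le) (sub_pos.2 huw).le
    nlinarith
  have hE : ∀ {z}, z ∈ critParams s t → ∑ l, t l * (z * s l) / (z * s l + t l) = 0 := by
    intro z hz
    rw [← mul_zero z, ← hz.2.2, Finset.mul_sum]
    exact Finset.sum_congr rfl fun l _ => by ring
  have hex : ∃ l, 0 < t l := by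
    by_contra! h'
    have := Finset.sum_nonpos fun l (_ : l ∈ Finset.univ) => h' l
    linarith
  obtain ⟨l, hl⟩ := hex
  have hlt := Finset.sum_lt_sum (fun l (_ : l ∈ Finset.univ) => hmono l)
    ⟨l, Finset.mem_univ l, by
      rw [div_lt_div_iff₀ (hu.2.1 l) (hw.2.1 l)]
      have := mul_pos (mul_pos (pow_pos hl 2) (h l)) (sub_pos.2 huw)
      nlinarith⟩
  rw [hE hu, hE hw] at hlt
  exact lt_irrefl _ hlt

/-- Same argument without the factor z: for positive tₗ the sum itself is strictly decreasing. -/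
theorem exists_neg_snd {s t : Fin 3 → ℝ} {u w : ℝ} (hu : u ∈ critParams s t)
    (hw : w ∈ critParams s t) (huw : u < w) (hs : ∑ l, s l = 1) : ∃ l, t l ≤ 0 := by
  by_contra! h
  have hmono : ∀ l, s l * t l / (w * s l + t l) ≤ s l * t l / (u * s l + t l) := by
    intro l
    rw [div_le_div_iff₀ (hw.2.1 l) (hu.2.1 l)]
    have := mul_nonneg (mul_nonneg (sq_nonneg (s l)) (h l).le) (sub_pos.2 huw).le
    nlinarith
  have hex : ∃ l, 0 < s l := by
    by_contra! h'
    have := Finset.sum_nonpos fun l (_ : l ∈ Finset.univ) => h' l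
    linarith
  obtain ⟨l, hl⟩ := hex
  have hlt := Finset.sum_lt_sum (fun l (_ : l ∈ Finset.univ) => hmono l)
    ⟨l, Finset.mem_univ l, by
      rw [div_lt_div_iff₀ (hw.2.1 l) (hu.2.1 l)]
      have := mul_pos (mul_pos (pow_pos hl 2) (h l)) (sub_pos.2 huw)
      nlinarith⟩
  rw [hu.2.2, hw.2.2] at hlt
  exact lt_irrefl _ hlt

/-- The sign and size conditions that place the two negative exponents in the two opposite
chambers of the triangle. -/
def ChamberSigns (s t : Fin 3 → ℝ) (i j k : Fin 3) : Prop :=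
  (s j < 0 ∧ 0 < s i ∧ 0 < s k ∧ s i < 1) ∧ (t i < 0 ∧ 0 < t j ∧ 0 < t k ∧ t j < 1)

theorem chamberSigns_of_mem {s t : Fin 3 → ℝ} (hs : ∑ l, s l = 1) (ht : ∑ l, t l = 1)
    {i j k : Fin 3} (hij : i ≠ j) (hki : k ≠ i) (hkj : k ≠ j) {u : ℝ}
    (hu : u ∈ critParams s t) (hsj : s j < 0) (hti : t i < 0) (hsk : 0 < s k) (htk : 0 < t k) :
    ChamberSigns s t i j k := by
  obtain ⟨h0, hpos, hsum⟩ := hu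
  rw [sum_eq_of_distinct hij hki hkj] at hs ht hsum
  have hi := hpos i
  have hj := hpos j
  have hk := hpos k
  have hsi : 0 < s i := pos_of_mul_pos_right (by linarith : 0 < u * s i) h0.le
  have htj : 0 < t j := by nlinarith
  -- Each term equals sₗ - u·sₗ²/(usₗ+tₗ) < sₗ. Bounding the j and k terms this way and the i term
  -- by 0 gives 0 < sⱼ + sₖ = 1 - sᵢ. The bound tⱼ < 1 is symmetric, after multiplying by u.
  have e1 : s j * t j / (u * s j + t j) < s j := by
    rw [div_lt_iff₀ hj]; nlinarith [mul_pos h0 (mul_pos_of_neg_of_neg hsj hsj)]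
  have e2 : s i * t i / (u * s i + t i) < 0 := div_neg_of_neg_of_pos (by nlinarith) hi
  have e3 : s k * t k / (u * s k + t k) < s k := by
    rw [div_lt_iff₀ hk]; nlinarith [mul_pos h0 (mul_pos hsk hsk)]
  have f1 : s j * t j / (u * s j + t j) < 0 := div_neg_of_neg_of_pos (by nlinarith) hj
  have f2 : u * (s i * t i / (u * s i + t i)) < t i := by
    rw [← mul_div_assoc, div_lt_iff₀ hi]; nlinarith [mul_pos_of_neg_of_neg hti hti]
  have f3 : u * (s k * t k / (u * s k + t k)) < t k := by
    rw [← mul_div_assoc, div_lt_iff₀ hk]; nlinarith [mul_pos htk htk]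
  refine ⟨⟨hsj, hsi, hsk, by linarith⟩, hti, htj, htk, ?_⟩
  have f4 := mul_neg_of_pos_of_neg h0 f1
  have : u * (s i * t i / (u * s i + t i)) + u * (s j * t j / (u * s j + t j)) +
      u * (s k * t k / (u * s k + t k)) = 0 := by
    rw [← mul_add, ← mul_add, hsum, mul_zero]
  linarith

/-- By Vieta the square root of the discriminant is a(w - u). With a = -x₁y₁z₁, z₁ = 1 - x₁ - y₁,
the inequalities reduce to wx₁ + x₂ > 0 at the larger root and uy₁ + y₂ > 0 at the smaller one. -/
theorem cuspInequalities_of_roots {x₁ y₁ x₂ y₂ u w : ℝ} (hx₁ : x₁ < 0) (hy₁ : 0 < y₁)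
    (hz₁ : 0 < 1 - x₁ - y₁) (huw : u < w)
    (hu : coeffA x₁ y₁ * u ^ 2 + coeffB x₁ y₁ x₂ y₂ * u + coeffC x₂ y₂ = 0)
    (hw : coeffA x₁ y₁ * w ^ 2 + coeffB x₁ y₁ x₂ y₂ * w + coeffC x₂ y₂ = 0)
    (hwx : 0 < w * x₁ + x₂) (huy : 0 < u * y₁ + y₂) : CuspInequalities x₁ y₁ x₂ y₂ := by
  have hb : coeffB x₁ y₁ x₂ y₂ = -(coeffA x₁ y₁ * (u + w)) := by
    apply mul_left_cancel₀ (sub_pos.2 huw).ne'; linear_combination hw - hu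
  have hc : coeffC x₂ y₂ = coeffA x₁ y₁ * (u * w) := by
    rw [hb] at hu; linear_combination hu
  have ha : coeffA x₁ y₁ = -x₁ * y₁ * (1 - x₁ - y₁) := rfl
  have hA : 0 < coeffA x₁ y₁ := by rw [ha]; have := neg_pos.2 hx₁; positivity
  simp only [CuspInequalities]
  have hd : coeffB x₁ y₁ x₂ y₂ ^ 2 - 4 * coeffA x₁ y₁ * coeffC x₂ y₂ =
      (coeffA x₁ y₁ * (w - u)) ^ 2 := by rw [hb, hc]; ring
  have hr : 0 < coeffA x₁ y₁ * (w - u) := mul_pos hA (sub_pos.2 huw)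
  have e1 : coeffA x₁ y₁ * (w - u) < 2 * x₂ * y₁ * (1 - x₁ - y₁) + coeffB x₁ y₁ x₂ y₂ := by
    rw [hb, ha]; nlinarith [mul_pos hwx (mul_pos hy₁ hz₁)]
  have e2 : coeffA x₁ y₁ * (w - u) < -(2 * x₁ * y₂ * (1 - x₁ - y₁) + coeffB x₁ y₁ x₂ y₂) := by
    rw [hb, ha]; nlinarith [mul_pos huy (mul_pos (neg_pos.2 hx₁) hz₁)]
  rw [hd]
  refine ⟨pow_pos hr 2, by gcongr, hr.trans e1, ?_, by linarith⟩
  rw [← neg_sq (2 * x₁ * y₂ * (1 - x₁ - y₁) + coeffB x₁ y₁ x₂ y₂)]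
  gcongr

theorem exists_roots_of_cuspInequalities {x₁ y₁ x₂ y₂ : ℝ} (hx₁ : x₁ < 0) (hy₁ : 0 < y₁)
    (hz₁ : 0 < 1 - x₁ - y₁) (h : CuspInequalities x₁ y₁ x₂ y₂) :
    ∃ u w, u < w ∧ 0 < w * x₁ + x₂ ∧ 0 < u * y₁ + y₂ ∧ ∀ z,
      coeffA x₁ y₁ * z ^ 2 + coeffB x₁ y₁ x₂ y₂ * z + coeffC x₂ y₂ = 0 ↔ z = u ∨ z = w := by
  have ha : coeffA x₁ y₁ = -x₁ * y₁ * (1 - x₁ - y₁) := rfl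
  have hA : 0 < coeffA x₁ y₁ := by rw [ha]; have := neg_pos.2 hx₁; positivity
  simp only [CuspInequalities] at h
  obtain ⟨h1, h2, h3, h4, h5⟩ := h
  set b := coeffB x₁ y₁ x₂ y₂
  set c := coeffC x₂ y₂
  set a := coeffA x₁ y₁
  set r := √(b ^ 2 - 4 * a * c) with hr
  have hr0 : 0 < r := Real.sqrt_pos.2 h1
  have hrr : r * r = b ^ 2 - 4 * a * c := Real.mul_self_sqrt h1.le
  have e1 : r < 2 * x₂ * y₁ * (1 - x₁ - y₁) + b := (Real.sqrt_lt' h3).2 h2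
  have e2 : r < -(2 * x₁ * y₂ * (1 - x₁ - y₁) + b) :=
    (Real.sqrt_lt' (by linarith)).2 (by rwa [neg_sq])
  refine ⟨(-b - r) / (2 * a), (-b + r) / (2 * a), by gcongr; linarith, ?_, ?_, fun z => ?_⟩
  · have : (-b + r) / (2 * a) * x₁ + x₂ =
        (2 * x₂ * y₁ * (1 - x₁ - y₁) + b - r) / (2 * (y₁ * (1 - x₁ - y₁))) := by
      rw [ha]; field_simp [hx₁.ne, hy₁.ne', hz₁.ne']; ring
    rw [this]; exact div_pos (by linarith) (by positivity)
  · have : (-b - r) / (2 * a) * y₁ + y₂ =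
        (-(2 * x₁ * y₂ * (1 - x₁ - y₁) + b) - r) / (2 * (-x₁ * (1 - x₁ - y₁))) := by
      rw [ha]; field_simp [hx₁.ne, hy₁.ne', hz₁.ne']; ring
    rw [this]
    have := neg_pos.2 hx₁
    exact div_pos (by linarith) (by positivity)
  · rw [pow_two, quadratic_eq_zero_iff hA.ne' (s := r) (by rw [discrim, hrr]), or_comm]

theorem encard_critParams_eq_two_iff {s t : Fin 3 → ℝ} (hs : ∑ l, s l = 1)
    (ht : ∑ l, t l = 1) :
    (critParams s t).encard = 2 ↔ ∃ i j k : Fin 3, i ≠ j ∧ k ≠ i ∧ k ≠ j ∧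
      ChamberSigns s t i j k ∧ CuspInequalities (s j) (s i) (t j) (t i) := by
  constructor
  · intro h
    obtain ⟨u, w, huw, hset⟩ : ∃ u w, u < w ∧ critParams s t = {u, w} := by
      obtain ⟨u, w, hne, h⟩ := Set.encard_eq_two.1 h
      rcases lt_or_gt_of_ne hne with h' | h'
      · exact ⟨u, w, h', h⟩
      · exact ⟨w, u, h', by rw [h, Set.pair_comm]⟩
    have hu : u ∈ critParams s t := by simp [hset]
    have hw : w ∈ critParams s t := by simp [hset]
    obtain ⟨j, hj⟩ := exists_neg_fst hu hw huw ht
    obtain ⟨i, hi⟩ := exists_neg_snd hu hw huw hs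
    have hij : i ≠ j := by
      rintro rfl
      have := hu.2.1 i
      nlinarith [hu.1]
    obtain ⟨k, hki, hkj⟩ := exists_third i j
    have hs' := hs
    have ht' := ht
    rw [sum_eq_of_distinct hij hki hkj] at hs' ht'
    have hk1 : s k = 1 - s j - s i := by linarith
    have hk2 : t k = 1 - t j - t i := by linarith
    obtain ⟨u0, ui, uj, uk, uq⟩ := (mem_critParams_iff hs ht hij hki hkj).1 hu
    obtain ⟨w0, wi, wj, wk, wq⟩ := (mem_critParams_iff hs ht hij hki hkj).1 hw
    have hb : coeffB (s j) (s i) (t j) (t i) = -(coeffA (s j) (s i) * (u + w)) := by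
      apply mul_left_cancel₀ (sub_pos.2 huw).ne'; linear_combination wq - uq
    have hc : coeffC (t j) (t i) = coeffA (s j) (s i) * (u * w) := by
      rw [hb] at uq; linear_combination uq
    -- If a = 0, Vieta makes the quadratic vanish identically, and the midpoint of the two roots
    -- would be a third critical parameter.
    have ha : coeffA (s j) (s i) ≠ 0 := by
      intro h0
      have hm : (u + w) / 2 ∈ critParams s t := by
        rw [mem_critParams_iff hs ht hij hki hkj, hb, hc, h0]
        refine ⟨by linarith, by linarith, by linarith, by linarith, by ring⟩
      rw [hset] at hm
      rcases hm with hm | hm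
      · linarith
      · rw [Set.mem_singleton_iff] at hm; linarith
    have hac : 0 < coeffA (s j) (s i) * coeffC (t j) (t i) := by
      rw [hc]
      have : 0 < coeffA (s j) (s i) ^ 2 * (u * w) := by positivity
      linarith [this]
    have hprod : 0 < (s j * s i * s k) * (t j * t i * t k) := by
      -- The leading and constant coefficients are -sᵢsⱼsₖ and -tᵢtⱼtₖ, so positivity of their
      -- product excludes zero coordinates and fixes the remaining signs.
      rw [hk1, hk2]
      unfold coeffA coeffC at hac
      linarith [hac]
    have hsi : 0 < s i := by
      by_contra! h'
      nlinarith
    have htj : 0 < t j := by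
      by_contra! h'
      nlinarith
    have hsj : s j < 0 := lt_of_le_of_ne hj fun h0 => by simp [h0] at hprod
    have hti : t i < 0 := lt_of_le_of_ne hi fun h0 => by simp [h0] at hprod
    have hkk : 0 < s k * t k := by
      have h1 : 0 < (s j * t i) * (s i * t j) :=
        mul_pos (mul_pos_of_neg_of_neg hsj hti) (mul_pos hsi htj)
      exact pos_of_mul_pos_right (by linarith : 0 < (s j * t i) * (s i * t j) * (s k * t k)) h1.le
    have hskk : 0 < s k ∧ 0 < t k := by
      rcases mul_pos_iff.1 hkk with h' | h'
      · exact h'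
      · nlinarith [h'.1, h'.2]
    refine ⟨i, j, k, hij, hki, hkj,
      chamberSigns_of_mem hs ht hij hki hkj hu hsj hti hskk.1 hskk.2,
      cuspInequalities_of_roots hsj hsi (hk1 ▸ hskk.1) huw uq wq wj ui⟩
  -- The bounds sᵢ < 1 and tⱼ < 1 are discarded here: they hold automatically at any critical
  -- parameter with these signs.
  · rintro ⟨i, j, k, hij, hki, hkj, ⟨⟨hsj, hsi, hsk, -⟩, hti, htj, htk, -⟩, hcusp⟩
    have hs' := hs
    rw [sum_eq_of_distinct hij hki hkj] at hs'
    have hk1 : s k = 1 - s j - s i := by linarith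
    obtain ⟨u, w, huw, hwj, hui, hroot⟩ :=
      exists_roots_of_cuspInequalities hsj hsi (hk1 ▸ hsk) hcusp
    have hu0 : 0 < u := pos_of_mul_pos_left (by linarith : 0 < u * s i) hsi.le
    refine Set.encard_eq_two.2 ⟨u, w, huw.ne, Set.ext fun z => ?_⟩
    rw [mem_critParams_iff hs ht hij hki hkj, hroot, Set.mem_insert_iff, Set.mem_singleton_iff]
    refine ⟨fun h => h.2.2.2.2, fun h => ?_⟩
    have hz : u ≤ z ∧ z ≤ w := by
      rcases h with rfl | rfl
      · exact ⟨le_rfl, huw.le⟩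
      · exact ⟨huw.le, le_rfl⟩
    have hz0 : 0 < z := hu0.trans_le hz.1
    exact ⟨hz0, by nlinarith, by nlinarith, by positivity, h⟩

/-! ### Critical points and the quadratic form on the kernel -/

theorem mulVec_homog_apply {m : ℕ} (B : Matrix (Fin m) (Fin 2) ℝ) (μ : Fin 1 → ℝ) (i : Fin m) :
    (B *ᵥ homog (k := 1) μ) i = B i 0 * μ 0 + B i 1 := by
  simp [Matrix.mulVec, dotProduct, homog, Fin.sum_univ_two, Fin.snoc]

theorem paramMap_apply {m : ℕ} (B : Matrix (Fin m) (Fin 2) ℝ) (μ : Fin 1 → ℝ) (j : Fin 2) :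
    paramMap (k := 1) B μ j = ∑ i, B i j * Real.log (B i 0 * μ 0 + B i 1) := by
  simp only [paramMap, Matrix.mulVec_eq_sum, Finset.sum_apply, Real.log_abs]
  simp [homog, Fin.sum_univ_two, Fin.snoc, mul_comm]

theorem jacobian_paramMap {m : ℕ} (B : Matrix (Fin m) (Fin 2) ℝ) (μ : Fin 1 → ℝ)
    (h : ∀ i, B i 0 * μ 0 + B i 1 ≠ 0) (j : Fin 2) (c : Fin 1) :
    jacobian (paramMap (k := 1) B) μ j c = ∑ i, B i j * (B i 0 / (B i 0 * μ 0 + B i 1)) := by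
  have hd : HasFDerivAt (paramMap (k := 1) B) (ContinuousLinearMap.pi fun j : Fin 2 =>
      ∑ i, B i j • ((B i 0 * μ 0 + B i 1)⁻¹ • (B i 0 •
        (ContinuousLinearMap.proj 0 : (Fin 1 → ℝ) →L[ℝ] ℝ)))) μ := by
    rw [hasFDerivAt_pi']
    intro j
    have : (fun μ => paramMap (k := 1) B μ j) =
        fun μ => ∑ i, B i j * Real.log (B i 0 * μ 0 + B i 1) := by
      funext μ; exact paramMap_apply B μ j
    rw [this, ContinuousLinearMap.proj_pi]
    refine HasFDerivAt.fun_sum fun i _ => ?_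
    have h0 : HasFDerivAt (fun μ : Fin 1 → ℝ => μ 0)
        (ContinuousLinearMap.proj 0 : (Fin 1 → ℝ) →L[ℝ] ℝ) μ := hasFDerivAt_apply 0 μ
    exact (((h0.const_mul (B i 0)).add_const (B i 1)).log (h i)).const_mul (B i j)
  rw [Subsingleton.elim c 0, jacobian, hd.fderiv, LinearMap.toMatrix'_apply]
  simp
  refine Finset.sum_congr rfl fun i _ => by ring

theorem rank_lt_one_iff {l : ℕ} (A : Matrix (Fin l) (Fin 1) ℝ) : A.rank < 1 ↔ A = 0 := by
  rw [Nat.lt_one_iff, Matrix.rank, Submodule.finrank_eq_zero, LinearMap.range_eq_bot,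
    ← Matrix.toLin'_apply', LinearEquiv.map_eq_zero_iff]

/-- A parameter is critical iff the first column of `B` is isotropic for the quadratic form
`∑ i, wᵢ² / λᵢ`. -/
theorem mem_criticalPoints_iff {m : ℕ} {B : Matrix (Fin m) (Fin 2) ℝ} {ε : Fin m → SignType}
    (hε : ∀ i, ε i ≠ 0) (hsum : ∑ i, B i 0 = 0) {μ : Fin 1 → ℝ} :
    μ ∈ criticalPoints (k := 1) B ε ↔
      (∀ i, SignType.sign (B i 0 * μ 0 + B i 1) = ε i) ∧
        ∑ i, B i 0 ^ 2 / (B i 0 * μ 0 + B i 1) = 0 := by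
  simp only [criticalPoints, paramDomain, Set.mem_ofPred_eq]
  refine (and_congr_left' (forall_congr' fun i =>
    iff_of_eq (congrArg (SignType.sign · = ε i) (mulVec_homog_apply B μ i)))).trans ?_
  refine and_congr_right fun hdom => ?_
  have hne : ∀ i, B i 0 * μ 0 + B i 1 ≠ 0 := fun i h0 => hε i (by rw [← hdom i, h0, sign_zero])
  rw [rank_lt_one_iff]
  have hcol : ∑ i, B i 0 * (B i 0 / (B i 0 * μ 0 + B i 1)) =
      ∑ i, B i 0 ^ 2 / (B i 0 * μ 0 + B i 1) :=
    Finset.sum_congr rfl fun i _ => by ring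
  constructor
  · intro h
    rw [← hcol, ← jacobian_paramMap B μ hne 0 0, h]; rfl
  · intro h
    ext j c
    rw [jacobian_paramMap B μ hne, Matrix.zero_apply]
    fin_cases j
    · exact hcol.trans h
    -- The second Jacobian entry is -μ times the first, because λ pairs to ∑ Bᵢ₀ = 0 with the first
    -- column.
    · have : ∀ i, B i 1 * (B i 0 / (B i 0 * μ 0 + B i 1)) =
          B i 0 - μ 0 * (B i 0 ^ 2 / (B i 0 * μ 0 + B i 1)) := by
        intro i; field_simp [hne i]; ring
      simp [this, Finset.sum_sub_distrib, ← Finset.mul_sum, h, hsum]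

theorem mem_ker_hatMatrix {m n : ℕ} {α : Fin m → Fin n → ℝ} {c : Fin m → ℝ} :
    c ∈ LinearMap.ker (hatMatrix α).mulVecLin ↔ ∑ i, c i = 0 ∧ ∑ i, c i • α i = 0 := by
  rw [LinearMap.mem_ker, Matrix.mulVecLin_apply, funext_iff, Fin.forall_fin_succ]
  simp [hatMatrix, Matrix.mulVec, dotProduct, funext_iff, Finset.sum_apply, mul_comm]

theorem IsGaleDual.mem_ker_iff {m n : ℕ} {α : Fin m → Fin n → ℝ} {B : Matrix (Fin m) (Fin 2) ℝ}
    (hB : IsGaleDual α B) {c : Fin m → ℝ} :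
    (∑ i, c i = 0 ∧ ∑ i, c i • α i = 0) ↔ ∃ x y : ℝ, ∀ i, c i = x * B i 0 + y * B i 1 := by
  rw [← mem_ker_hatMatrix, ← hB.2, Submodule.mem_span_range_iff_exists_fun]
  constructor
  · rintro ⟨f, rfl⟩
    exact ⟨f 0, f 1, fun i => by simp [Fin.sum_univ_two]⟩
  · rintro ⟨x, y, h⟩
    exact ⟨![x, y], funext fun i => by simp [Fin.sum_univ_two, h]⟩

theorem IsGaleDual.sum_col_zero {m n : ℕ} {α : Fin m → Fin n → ℝ}
    {B : Matrix (Fin m) (Fin 2) ℝ} (hB : IsGaleDual α B) : ∑ i, B i 0 = 0 :=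
  (hB.mem_ker_iff.2 ⟨1, 0, fun i => by ring⟩ : (∑ i, B i 0 = 0 ∧ _)).1

theorem IsGaleDual.sum_col_one {m n : ℕ} {α : Fin m → Fin n → ℝ}
    {B : Matrix (Fin m) (Fin 2) ℝ} (hB : IsGaleDual α B) : ∑ i, B i 1 = 0 :=
  (hB.mem_ker_iff.2 ⟨0, 1, fun i => by ring⟩ : (∑ i, B i 1 = 0 ∧ _)).1

theorem IsGaleDual.sum_sq_div_eq_zero {m n : ℕ} {α : Fin m → Fin n → ℝ}
    {B : Matrix (Fin m) (Fin 2) ℝ} (hB : IsGaleDual α B) {μ : ℝ}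
    (hne : ∀ i, B i 0 * μ + B i 1 ≠ 0)
    (hμ : ∑ i, B i 0 ^ 2 / (B i 0 * μ + B i 1) = 0) {c : Fin m → ℝ}
    (hc : ∑ i, c i = 0) (hc' : ∑ i, c i • α i = 0) :
    ∑ i, c i ^ 2 / (B i 0 * μ + B i 1) = 0 := by
  obtain ⟨x, y, h⟩ := hB.mem_ker_iff.1 ⟨hc, hc'⟩
  have : ∀ i, c i ^ 2 / (B i 0 * μ + B i 1) =
      (x - y * μ) ^ 2 * (B i 0 ^ 2 / (B i 0 * μ + B i 1)) +
        (2 * (x - y * μ) * y + y ^ 2 * μ) * B i 0 + y ^ 2 * B i 1 := by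
    intro i; rw [h]; field_simp [hne i]; ring
  simp [this, Finset.sum_add_distrib, ← Finset.mul_sum, hμ, hB.sum_col_zero, hB.sum_col_one]

/-- At a critical point, the exponents of a fixed sign are affinely independent. -/
theorem affineIndependent_of_mem_criticalPoints {m n : ℕ} {α : Fin m → Fin n → ℝ}
    {B : Matrix (Fin m) (Fin 2) ℝ} (hB : IsGaleDual α B) {ε : Fin m → SignType}
    (hε : ∀ i, ε i ≠ 0) {μ : Fin 1 → ℝ} (hμ : μ ∈ criticalPoints (k := 1) B ε) (σ : SignType) :
    AffineIndependent ℝ (fun i : {i | ε i = σ} => α i) := by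
  classical
  obtain ⟨hdom, hq⟩ := (mem_criticalPoints_iff hε hB.sum_col_zero).1 hμ
  have hne : ∀ i, B i 0 * μ 0 + B i 1 ≠ 0 := fun i h0 => hε i (by rw [← hdom i, h0, sign_zero])
  rw [affineIndependent_iff_of_fintype]
  intro w hw hw'
  rw [Finset.weightedVSub_eq_linear_combination _ hw] at hw'
  -- Extension by zero turns a relation within one sign class into a kernel vector; on its support λ
  -- has constant sign σ, so the form is definite there.
  set c : Fin m → ℝ := fun i => if h : ε i = σ then w ⟨i, h⟩ else 0 with hcdef
  have key : ∀ (E : Type) [AddCommGroup E] [Module ℝ E] (f : Fin m → E),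
      ∑ i, c i • f i = ∑ i : {i | ε i = σ}, w i • f i := by
    intro E _ _ f
    rw [← Finset.sum_subset (Finset.subset_univ (Finset.univ.filter fun i => ε i = σ))]
    · refine Finset.sum_bij' (fun i hi => ⟨i, (Finset.mem_filter.1 hi).2⟩) (fun i _ => i) ?_ ?_ ?_ ?_ ?_
      · simp
      · intro i _; exact Finset.mem_filter.2 ⟨Finset.mem_univ _, i.2⟩
      · simp
      · simp
      · intro i hi; simp [hcdef, (Finset.mem_filter.1 hi).2]
    · intro i _ hi
      have : ε i ≠ σ := by simpa using hi
      simp [hcdef, this]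
  have h1 : ∑ i, c i = 0 := by
    have := key ℝ (fun _ => 1)
    simpa [hw] using this
  have h2 : ∑ i, c i • α i = 0 := by rw [key, hw']
  have h3 := hB.sum_sq_div_eq_zero hne hq h1 h2
  have h4 : ∀ i, (σ : ℝ) * (c i ^ 2 / (B i 0 * μ 0 + B i 1)) =
      c i ^ 2 / |B i 0 * μ 0 + B i 1| := by
    intro i
    by_cases h : ε i = σ
    · rw [← h, ← hdom i]
      rcases lt_or_gt_of_ne (hne i) with h' | h'
      · rw [sign_neg h', abs_of_neg h', div_neg]; simp
      · rw [sign_pos h', abs_of_pos h']; simp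
    · simp [hcdef, h]
  have h5 : ∑ i, c i ^ 2 / |B i 0 * μ 0 + B i 1| = 0 := by
    rw [← Finset.sum_congr rfl fun i _ => h4 i, ← Finset.mul_sum, h3, mul_zero]
  rw [Finset.sum_eq_zero_iff_of_nonneg fun i _ => by positivity] at h5
  intro i
  have h6 := h5 i (Finset.mem_univ _)
  rw [div_eq_zero_iff, or_iff_left (abs_ne_zero.2 (hne i)), sq_eq_zero_iff] at h6
  have : ε i = σ := i.2
  simpa [hcdef, this] using h6

/-! ### The 3/2 sign splitting -/

theorem convDim_eq {n : ℕ} (S : Set (Fin n → ℝ)) :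
    convDim S = Module.finrank ℝ (vectorSpan ℝ S) := by
  rw [convDim, ← direction_affineSpan, affineSpan_convexHull, direction_affineSpan]

theorem sign_split_of_mem_criticalPoints {α : Fin 5 → Fin 2 → ℝ} (hα : Function.Injective α)
    {B : Matrix (Fin 5) (Fin 2) ℝ} (hB : IsGaleDual α B) {ε : Fin 5 → SignType}
    (hε : ∀ i, ε i ≠ 0) {μ : Fin 1 → ℝ} (hμ : μ ∈ criticalPoints (k := 1) B ε) :
    ((posPart α ε).encard = 3 ∧ (negPart α ε).encard = 2 ∧ convDim (posPart α ε) = 2) ∨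
      ((posPart α ε).encard = 2 ∧ (negPart α ε).encard = 3 ∧ convDim (negPart α ε) = 2) := by
  classical
  have hp := affineIndependent_of_mem_criticalPoints hB hε hμ 1
  have hn := affineIndependent_of_mem_criticalPoints hB hε hμ (-1)
  have hcard : ∀ σ : SignType, (α '' {i | ε i = σ}).encard =
      (Fintype.card {i | ε i = σ} : ℕ) := by
    intro σ
    rw [hα.injOn.encard_image, Set.encard_eq_coe_toFinset_card, Set.toFinset_card]
  have hdim : ∀ σ : SignType, AffineIndependent ℝ (fun i : {i | ε i = σ} => α i) →
      Fintype.card {i | ε i = σ} = 3 → convDim (α '' {i | ε i = σ}) = 2 := by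
    intro σ h h3
    rw [convDim_eq, Set.image_eq_range]
    exact h.finrank_vectorSpan h3
  have hle : ∀ σ : SignType, AffineIndependent ℝ (fun i : {i | ε i = σ} => α i) →
      Fintype.card {i | ε i = σ} ≤ 3 := by
    intro σ h
    refine h.card_le_finrank_succ.trans ?_
    have := Submodule.finrank_le (vectorSpan ℝ (Set.range fun i : {i | ε i = σ} => α i))
    rw [Module.finrank_fin_fun] at this
    omega
  have htot : Fintype.card {i | ε i = 1} + Fintype.card {i | ε i = -1} = 5 := by
    have h1 : ∀ i, ε i = -1 ↔ ¬ ε i = 1 := by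
      intro i
      have := hε i
      revert this; generalize ε i = a; revert a; decide
    have h2 := Fintype.card_subtype_compl (fun i : Fin 5 => ε i = 1)
    have h3 := Fintype.card_subtype_le (fun i : Fin 5 => ε i = 1)
    have h4 : Fintype.card {i | ε i = -1} = Fintype.card {i // ¬ ε i = 1} :=
      Fintype.card_congr (Equiv.subtypeEquivRight h1)
    have h5 : Fintype.card {i | ε i = 1} = Fintype.card {i // ε i = 1} :=
      Fintype.card_congr (Equiv.refl _)
    rw [Fintype.card_fin] at h2 h3
    omega
  have hp3 := hle _ hp
  have hn3 := hle _ hn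
  unfold posPart negPart
  rw [hcard, hcard]
  rcases (by omega : Fintype.card {i | ε i = 1} = 3 ∧ Fintype.card {i | ε i = -1} = 2 ∨
    Fintype.card {i | ε i = 1} = 2 ∧ Fintype.card {i | ε i = -1} = 3) with ⟨h, h'⟩ | ⟨h, h'⟩
  · left; rw [h, h']; exact ⟨rfl, rfl, hdim _ hp h⟩
  · right; rw [h, h']; exact ⟨rfl, rfl, hdim _ hn h'⟩

/-! ### Chambers and normalized coordinates -/

/-- A nonzero linear functional is continuous and open, so taking interiors commutes with its
preimage. -/
theorem interior_upperHalf {n : ℕ} {v : Fin n → ℝ} (hv : v ≠ 0) (a : ℝ) :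
    interior (upperHalf v a) = {x | a < v ⬝ᵥ x} ∧ interior (lowerHalf v a) = {x | v ⬝ᵥ x < a} := by
  let f : (Fin n → ℝ) →ₗ[ℝ] ℝ := dotProductBilin ℝ ℝ v
  have hf : ∀ x, f x = v ⬝ᵥ x := fun x => rfl
  have hcont : Continuous f := f.continuous_of_finiteDimensional
  have hsurj : Function.Surjective f := by
    apply f.surjective
    intro h0
    apply hv
    rw [← dotProduct_self_eq_zero, ← hf, h0, LinearMap.zero_apply]
  have hopen : IsOpenMap f := f.isOpenMap_of_finiteDimensional hsurj
  have h1 := hopen.preimage_interior_eq_interior_preimage hcont (Set.Ici a)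
  have h2 := hopen.preimage_interior_eq_interior_preimage hcont (Set.Iic a)
  rw [interior_Ici] at h1
  rw [interior_Iic] at h2
  exact ⟨h1.symm, h2.symm⟩

theorem mem_interior_posSubChamber {p v : Fin 3 → Fin 2 → ℝ} {d : Fin 3 → ℝ}
    (hv : ∀ i, v i ≠ 0) (i j : Fin 3) (x : Fin 2 → ℝ) :
    x ∈ interior (posSubChamber p v d i j) ↔
      (∀ l, l ≠ i → d l < v l ⬝ᵥ x) ∧ v i ⬝ᵥ x < d i ∧ v j ⬝ᵥ x < v j ⬝ᵥ p j := by
  have h : (⋂ l ∈ {l : Fin 3 | l ≠ i}, upperHalf (v l) (d l)) =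
      ⋂ l : {l : Fin 3 // l ≠ i}, upperHalf (v l) (d l) := by
    ext x; simp
  rw [posSubChamber, posChamber, interior_inter, interior_inter, h, interior_iInter_of_finite,
    (interior_upperHalf (hv i) _).2, (interior_upperHalf (hv j) _).2]
  simp [(interior_upperHalf (hv _) _).1, and_assoc]

/-- Barycentric coordinates with respect to a nondegenerate triangle in the plane. -/
theorem exists_barycentric {p : Fin 3 → Fin 2 → ℝ} (hp : convDim (Set.range p) = 2)
    (x : Fin 2 → ℝ) : ∃ s : Fin 3 → ℝ, ∑ l, s l = 1 ∧ ∑ l, s l • p l = x := by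
  rw [convDim_eq] at hp
  have hind : AffineIndependent ℝ p :=
    (affineIndependent_iff_finrank_vectorSpan_eq ℝ p (by simp)).2 hp
  have htop : affineSpan ℝ (Set.range p) = ⊤ :=
    hind.affineSpan_eq_top_iff_card_eq_finrank_add_one.2 (by simp)
  let b : AffineBasis (Fin 3) ℝ (Fin 2 → ℝ) := ⟨p, hind, htop⟩
  exact ⟨fun l => b.coord l x, b.sum_coord_apply_eq_one x, b.linear_combination_coord_eq_self x⟩

theorem IsFacetHyperplanes.height_pos {p v : Fin 3 → Fin 2 → ℝ} {d : Fin 3 → ℝ}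
    (h : IsFacetHyperplanes p v d) (l : Fin 3) : 0 < v l ⬝ᵥ p l - d l := by
  have h1 : p l ∈ convexHull ℝ (Set.range p) := subset_convexHull _ _ ⟨l, rfl⟩
  rw [h.hull_eq, Set.mem_iInter] at h1
  exact sub_pos.2 (lt_of_le_of_ne (h1 l) (Ne.symm (h.opposite l)))

/-- The affine function vₗ·x - dₗ vanishes at the vertices other than pₗ, so it is the barycentric
coordinate scaled by the height of pₗ. This turns chamber membership into bounds on coordinates. -/
theorem IsFacetHyperplanes.dotProduct_sub {p v : Fin 3 → Fin 2 → ℝ} {d : Fin 3 → ℝ}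
    (h : IsFacetHyperplanes p v d) {s : Fin 3 → ℝ} (hs : ∑ l, s l = 1) (l : Fin 3) :
    v l ⬝ᵥ (∑ m, s m • p m) - d l = s l * (v l ⬝ᵥ p l - d l) := by
  have h1 : ∀ m, s m * (v l ⬝ᵥ p m - d l) = if m = l then s l * (v l ⬝ᵥ p l - d l) else 0 := by
    intro m
    split_ifs with hm
    · rw [hm]
    · have : v l ⬝ᵥ p m = d l := h.facet l m hm
      rw [this, sub_self, mul_zero]
  rw [dotProduct_sum]
  simp only [dotProduct_smul, smul_eq_mul]
  calc ∑ m, s m * v l ⬝ᵥ p m - d l = ∑ m, s m * (v l ⬝ᵥ p m - d l) := by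
        simp only [mul_sub, Finset.sum_sub_distrib, ← Finset.sum_mul, hs, one_mul]
    _ = _ := by rw [Finset.sum_congr rfl fun m _ => h1 m, Finset.sum_ite_eq' Finset.univ l]; simp

theorem IsFacetHyperplanes.mem_interior_posSubChamber_iff {p v : Fin 3 → Fin 2 → ℝ}
    {d : Fin 3 → ℝ} (h : IsFacetHyperplanes p v d) {s : Fin 3 → ℝ} (hs : ∑ l, s l = 1)
    {i j k : Fin 3} (hij : i ≠ j) (hki : k ≠ i) (hkj : k ≠ j) :
    ∑ l, s l • p l ∈ interior (posSubChamber p v d j i) ↔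
      s j < 0 ∧ 0 < s i ∧ 0 < s k ∧ s i < 1 := by
  rw [mem_interior_posSubChamber h.ne_zero, forall_iff_of_distinct hij hki hkj]
  have hd := h.dotProduct_sub hs
  have hpos := h.height_pos
  have e1 : ∀ l, d l < v l ⬝ᵥ (∑ m, s m • p m) ↔ 0 < s l := by
    intro l
    rw [← sub_pos, hd, mul_pos_iff_of_pos_right (hpos l)]
  have e2 : ∀ l, v l ⬝ᵥ (∑ m, s m • p m) < d l ↔ s l < 0 := by
    intro l
    rw [← sub_neg, hd, ← neg_pos, ← neg_mul, mul_pos_iff_of_pos_right (hpos l), neg_pos]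
  have e3 : ∀ l, v l ⬝ᵥ (∑ m, s m • p m) < v l ⬝ᵥ p l ↔ s l < 1 := by
    intro l
    rw [← sub_lt_sub_iff_right (d l), hd, mul_lt_iff_lt_one_left (hpos l)]
  simp only [e1, e2, e3]
  simp only [ne_eq, hij, not_false_eq_true, forall_const, not_true_eq_false, false_imp_iff, hkj,
    true_and]
  tauto

/-- The affine map sends pₖ, pⱼ, pᵢ to 0, e₁, e₂, so the normalized coordinates are two of the
barycentric ones. -/
theorem mulVec_barycentric {p : Fin 3 → Fin 2 → ℝ} {s : Fin 3 → ℝ} (hs : ∑ l, s l = 1)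
    {i j k : Fin 3} (hij : i ≠ j) (hki : k ≠ i) (hkj : k ≠ j) {M : Matrix (Fin 2) (Fin 2) ℝ}
    {w : Fin 2 → ℝ} (hj : M *ᵥ (p j - p k) = ![1, 0]) (hi : M *ᵥ (p i - p k) = ![0, 1])
    (hw : w = -(M *ᵥ p k)) : M *ᵥ (∑ l, s l • p l) + w = ![s j, s i] := by
  rw [sum_eq_of_distinct hij hki hkj] at hs
  have h3 : (∑ l, s l • p l) - p k = s j • (p j - p k) + s i • (p i - p k) := by
    ext r
    have := sum_eq_of_distinct hij hki hkj (fun l => s l * p l r)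
    simp only [Pi.sub_apply, Pi.add_apply, Pi.smul_apply, Finset.sum_apply, smul_eq_mul, this]
    linear_combination p k r * hs
  rw [hw, ← sub_eq_add_neg, ← Matrix.mulVec_sub, h3, Matrix.mulVec_add, Matrix.mulVec_smul,
    Matrix.mulVec_smul, hj, hi]
  ext r
  fin_cases r <;> simp

theorem exists_normalizing_matrix {p : Fin 3 → Fin 2 → ℝ} (hp : convDim (Set.range p) = 2)
    {i j k : Fin 3} (hij : i ≠ j) (hki : k ≠ i) (hkj : k ≠ j) :
    ∃ M : Matrix (Fin 2) (Fin 2) ℝ, IsUnit M ∧ M *ᵥ (p j - p k) = ![1, 0] ∧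
      M *ᵥ (p i - p k) = ![0, 1] := by
  rw [convDim_eq] at hp
  let N : Matrix (Fin 2) (Fin 2) ℝ := (Matrix.of ![p j - p k, p i - p k])ᵀ
  have hN : IsUnit N := by
    rw [← Matrix.mulVec_surjective_iff_isUnit]
    intro y
    have hp' : vectorSpan ℝ (Set.range p) = ⊤ :=
      Submodule.eq_top_of_finrank_eq (by rw [hp]; simp)
    rw [vectorSpan_range_eq_span_range_vsub_right ℝ p k] at hp'
    obtain ⟨c, hc⟩ := (Submodule.mem_span_range_iff_exists_fun ℝ).1
      (hp' ▸ Submodule.mem_top : y ∈ _)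
    refine ⟨![c j, c i], ?_⟩
    rw [← hc]
    ext r
    have := sum_eq_of_distinct hij hki hkj (fun l => c l * (p l r - p k r))
    simp [N, Matrix.mulVec, dotProduct, Fin.sum_univ_two, Finset.sum_apply, this]
    ring
  have hdet := (Matrix.isUnit_iff_isUnit_det N).1 hN
  have hcol : ∀ r : Fin 2, N⁻¹ *ᵥ N.col r = Pi.single r 1 := by
    intro r
    rw [← Matrix.mulVec_single_one, Matrix.mulVec_mulVec, Matrix.nonsing_inv_mul N hdet,
      Matrix.one_mulVec]
  refine ⟨N⁻¹, (Matrix.isUnit_nonsing_inv_iff).2 hN, (hcol 0).trans ?_, (hcol 1).trans ?_⟩ <;>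
  · ext r; fin_cases r <;> simp

/-! ### From the Gale dual to barycentric coordinates -/

/-- The parameter `u = -B₃₀ (μ - x)` identifies the critical points with `critParams s t`. -/
theorem encard_criticalPoints_eq {α : Fin 5 → Fin 2 → ℝ} {B : Matrix (Fin 5) (Fin 2) ℝ}
    (hB : IsGaleDual α B) (hlast : B 4 = ![0, -1]) {s t : Fin 3 → ℝ} (hs : ∑ l, s l = 1)
    (ht : ∑ l, t l = 1) (hs' : ∑ l, s l • ![α 0, α 1, α 2] l = α 3)
    (ht' : ∑ l, t l • ![α 0, α 1, α 2] l = α 4) :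
    (criticalPoints (k := 1) B ![1, 1, 1, -1, -1]).encard = (critParams s t).encard := by
  have hB40 : B 4 0 = 0 := by simp [hlast]
  have hB41 : B 4 1 = -1 := by simp [hlast]
  obtain ⟨x, y, hxy⟩ := (hB.mem_ker_iff (c := ![s 0, s 1, s 2, -1, 0])).1 (by
    simp only [Fin.sum_univ_three] at hs hs'
    simp [Fin.sum_univ_five, hs, ← hs']
    abel)
  obtain ⟨x', y', hxy'⟩ := (hB.mem_ker_iff (c := ![t 0, t 1, t 2, 0, -1])).1 (by
    simp only [Fin.sum_univ_three] at ht ht'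
    simp [Fin.sum_univ_five, ht, ← ht']
    abel)
  have a0 := hxy 0
  have a1 := hxy 1
  have a2 := hxy 2
  have a3 := hxy 3
  have a4 := hxy 4
  have b0 := hxy' 0
  have b1 := hxy' 1
  have b2 := hxy' 2
  have b3 := hxy' 3
  have b4 := hxy' 4
  simp only [Matrix.cons_val, hB40, hB41] at a0 a1 a2 a3 a4 b0 b1 b2 b3 b4
  -- The last row (0,-1) of B determines the second-column coefficients of both kernel vectors.
  obtain rfl : y = 0 := by linarith
  obtain rfl : y' = 1 := by linarith
  set β := B 3 0 with hβ
  have hβ0 : β ≠ 0 := by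
    intro h0
    rw [h0] at a3
    linarith
  have c0 : B 0 0 = -β * s 0 := by linear_combination β * a0 - B 0 0 * a3
  have c1 : B 1 0 = -β * s 1 := by linear_combination β * a1 - B 1 0 * a3
  have c2 : B 2 0 = -β * s 2 := by linear_combination β * a2 - B 2 0 * a3
  let g : (Fin 1 → ℝ) → ℝ := fun μ => -β * (μ 0 - x')
  have hg : Function.Bijective g := by
    constructor
    · intro μ ν h
      ext r
      rw [Subsingleton.elim r 0]
      have := mul_left_cancel₀ (neg_ne_zero.2 hβ0) h
      linarith
    · intro u
      exact ⟨fun _ => x' - u / β, by simp only [g]; field_simp; ring⟩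
  rw [← Set.encard_preimage_of_bijective hg (critParams s t)]
  congr 1
  ext μ
  rw [mem_criticalPoints_iff (by decide) hB.sum_col_zero, Set.mem_preimage]
  set u := g μ with hu
  have l0 : B 0 0 * μ 0 + B 0 1 = u * s 0 + t 0 := by
    rw [b0, hu]; simp only [g]; rw [c0]; ring
  have l1 : B 1 0 * μ 0 + B 1 1 = u * s 1 + t 1 := by
    rw [b1, hu]; simp only [g]; rw [c1]; ring
  have l2 : B 2 0 * μ 0 + B 2 1 = u * s 2 + t 2 := by
    rw [b2, hu]; simp only [g]; rw [c2]; ring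
  have l3 : β * μ 0 + B 3 1 = -u := by
    rw [hu]; simp only [g]; linear_combination -b3
  simp only [Fin.forall_fin_succ, Fin.sum_univ_five, critParams, Set.mem_ofPred_eq,
    Fin.sum_univ_three]
  simp only [Fin.succ_zero_eq_one, Fin.succ_one_eq_two, IsEmpty.forall_iff, and_true,
    Fin.reduceSucc, l0, l1, l2, l3, hB40, hB41, ← hβ, Matrix.cons_val, sign_eq_one_iff,
    sign_eq_neg_one_iff]
  rw [c0, c1, c2]
  have key : 0 < u → 0 < u * s 0 + t 0 → 0 < u * s 1 + t 1 → 0 < u * s 2 + t 2 →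
      ((-β * s 0) ^ 2 / (u * s 0 + t 0) + (-β * s 1) ^ 2 / (u * s 1 + t 1) +
        (-β * s 2) ^ 2 / (u * s 2 + t 2) + β ^ 2 / -u + 0 ^ 2 / (0 * μ 0 + -1) = 0 ↔
      s 0 * t 0 / (u * s 0 + t 0) + s 1 * t 1 / (u * s 1 + t 1) +
        s 2 * t 2 / (u * s 2 + t 2) = 0) := by
    intro hu0 h0 h1 h2
    -- This identity, summed using ∑ sₗ = 1, trades ∑ sₗ²/(usₗ+tₗ) - 1/u for -1/u times ∑
    -- sₗtₗ/(usₗ+tₗ).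
    have e : ∀ l, 0 < u * s l + t l → s l * t l / (u * s l + t l) =
        s l - u * (s l ^ 2 / (u * s l + t l)) := by
      intro l hl
      rw [eq_sub_iff_add_eq, ← mul_div_assoc, ← add_div, div_eq_iff hl.ne']
      ring
    rw [Fin.sum_univ_three] at hs
    have : (-β * s 0) ^ 2 / (u * s 0 + t 0) + (-β * s 1) ^ 2 / (u * s 1 + t 1) +
        (-β * s 2) ^ 2 / (u * s 2 + t 2) + β ^ 2 / -u + 0 ^ 2 / (0 * μ 0 + -1) =
        -(β ^ 2 / u) * (s 0 * t 0 / (u * s 0 + t 0) + s 1 * t 1 / (u * s 1 + t 1) +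
        s 2 * t 2 / (u * s 2 + t 2)) := by
      have hu1 : β ^ 2 / u * u = β ^ 2 := div_mul_cancel₀ _ hu0.ne'
      rw [e 0 h0, e 1 h1, e 2 h2, div_neg]
      simp only [mul_pow, neg_sq, mul_div_assoc]
      linear_combination (-(s 0 ^ 2 / (u * s 0 + t 0)) - s 1 ^ 2 / (u * s 1 + t 1) -
        s 2 ^ 2 / (u * s 2 + t 2)) * hu1 + β ^ 2 / u * hs
    rw [this, mul_eq_zero, or_iff_right]
    exact neg_ne_zero.2 (div_ne_zero (pow_ne_zero 2 hβ0) hu0.ne')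
  constructor
  · rintro ⟨⟨h0, h1, h2, h3, -⟩, h⟩
    have hu0 : 0 < u := by linarith
    exact ⟨hu0, ⟨h0, h1, h2⟩, (key hu0 h0 h1 h2).1 h⟩
  · rintro ⟨hu0, ⟨h0, h1, h2⟩, h⟩
    exact ⟨⟨h0, h1, h2, by linarith, by norm_num⟩, (key hu0 h0 h1 h2).2 h⟩

end FiveNomial

theorem theorem5p5
    (α : Fin 5 → Fin 2 → ℝ) (hα : Function.Injective α)
    (ε : Fin 5 → SignType) (hε : ∀ i, ε i ≠ 0)
    (hdim : FiveNomial.convDim (Set.range α) = 2)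
    (B : Matrix (Fin 5) (Fin 2) ℝ) (hB : FiveNomial.IsGaleDual α B)
    (hlast : B 4 = ![0, -1]) :
    -- two critical points force a `3/2` sign splitting with a nondegenerate triangle
    ((FiveNomial.criticalPoints (k := 1) B ε).encard = 2 →
      ((FiveNomial.posPart α ε).encard = 3 ∧ (FiveNomial.negPart α ε).encard = 2 ∧
          FiveNomial.convDim (FiveNomial.posPart α ε) = 2) ∨
      ((FiveNomial.posPart α ε).encard = 2 ∧ (FiveNomial.negPart α ε).encard = 3 ∧
          FiveNomial.convDim (FiveNomial.negPart α ε) = 2)) ∧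
    -- the characterization for positive vectors `p 0, p 1, p 2` spanning a triangle
    (ε = ![1, 1, 1, -1, -1] →
      ∀ p : Fin 3 → Fin 2 → ℝ, p = ![α 0, α 1, α 2] →
      FiveNomial.convDim (Set.range p) = 2 →
      ∀ (v : Fin 3 → Fin 2 → ℝ) (d : Fin 3 → ℝ), FiveNomial.IsFacetHyperplanes p v d →
      ((FiveNomial.criticalPoints (k := 1) B ε).encard = 2 ↔
        ∃ i j k : Fin 3, i ≠ j ∧ k ≠ i ∧ k ≠ j ∧
          α 3 ∈ interior (FiveNomial.posSubChamber p v d j i) ∧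
          α 4 ∈ interior (FiveNomial.posSubChamber p v d i j) ∧
          ∃ (M : Matrix (Fin 2) (Fin 2) ℝ) (w : Fin 2 → ℝ),
            IsUnit M ∧ M *ᵥ (p j - p k) = ![1, 0] ∧ M *ᵥ (p i - p k) = ![0, 1] ∧
            w = -(M *ᵥ p k) ∧
            FiveNomial.CuspInequalities
              ((M *ᵥ α 3 + w) 0) ((M *ᵥ α 3 + w) 1)
              ((M *ᵥ α 4 + w) 0) ((M *ᵥ α 4 + w) 1))) := by
  open FiveNomial in
  refine ⟨fun h => ?_, fun hε' p hp hpdim v d hF => ?_⟩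
  · obtain ⟨μ, hμ⟩ := Set.nonempty_of_encard_ne_zero (h.trans_ne two_ne_zero)
    exact sign_split_of_mem_criticalPoints hα hB hε hμ
  · obtain ⟨s, hs, hs'⟩ := exists_barycentric hpdim (α 3)
    obtain ⟨t, ht, ht'⟩ := exists_barycentric hpdim (α 4)
    rw [hε', encard_criticalPoints_eq hB hlast hs ht (hp ▸ hs') (hp ▸ ht'),
      encard_critParams_eq_two_iff hs ht]
    refine exists_congr fun i => exists_congr fun j => exists_congr fun k =>
      and_congr_right fun hij => and_congr_right fun hki => and_congr_right fun hkj => ?_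
    rw [← and_assoc, ← hs', ← ht', hF.mem_interior_posSubChamber_iff hs hij hki hkj,
      hF.mem_interior_posSubChamber_iff ht hij.symm hkj hki]
    -- The quantifier over M is harmless: every admissible M yields the same coordinates, namely
    -- (sⱼ, sᵢ) and (tⱼ, tᵢ).
    refine and_congr_right fun _ => ⟨fun h => ?_, ?_⟩
    · obtain ⟨M, hM, hj, hi⟩ := exists_normalizing_matrix hpdim hij hki hkj
      refine ⟨M, _, hM, hj, hi, rfl, ?_⟩
      rw [mulVec_barycentric hs hij hki hkj hj hi rfl, mulVec_barycentric ht hij hki hkj hj hi rfl]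
      exact h
    · rintro ⟨M, w, -, hj, hi, hw, h⟩
      rw [mulVec_barycentric hs hij hki hkj hj hi hw,
        mulVec_barycentric ht hij hki hkj hj hi hw] at h
      exact h
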